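/- Let $\Sigma=\{0,1,2,3\}$ and let $n\ge 1$. An $n$-ary quasigroup of order $4$ is an operation $f\colon\Sigma^n\to\Sigma$ that is invertible in each argument. An autotopy of $f$ is a tuple $\theta=(\theta_0,\theta_1,\ldots,\theta_n)$ of permutations of $\Sigma$ such that $f(\theta_1x_1,\ldots,\theta_nx_n)=\theta_0 f(x_1,\ldots,x_n)$ for all $x\in\Sigma^n$; under componentwise composition the autotopies form a group $\mathrm{Atp}(f)$, which acts on the code $M(f)=\{(x_0,x_1,\ldots,x_n)\in\Sigma^{n+1} : x_0=f(x_1,\ldots,x_n)\}$ by $x\mapsto(\theta_0x_0,\ldots,\theta_nx_n)$. Two quasigroups $f,g$ are isotopic if $g(x_1,\ldots,x_n)=\theta_0^{-1}f(\theta_1x_1,\ldots,\theta_nx_n)$ for some permutations $\theta_0,\ldots,\theta_n$ of $\Sigma$. The quasigroup $f$ is semilinear if there are $a_j\neq b_j$ in $\Sigma$, $j=0,\ldots,n$, such that $f(\{a_1,b_1\}\times\cdots\times\{a_n,b_n\})=\{a_0,b_0\}$; it is then called $\{a_j,b_j\}$-semilinear in the $j$-th argument. It is linear if for every $j\in\{0,\ldots,n\}$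 and all $a\ne b$ in $\Sigma$ it is $\{a,b\}$-semilinear in the $j$-th argument. Let $\oplus$ be the bitwise exclusive or on $\Sigma$ (so $(\Sigma,\oplus)\cong\mathbb Z_2\times\mathbb Z_2$). (i) The maximum order of the autotopy group of an $n$-ary quasigroup of order $4$ equals $6\cdot 4^n$. An $n$-ary quasigroup of order $4$ attains this maximum if and only if it is linear, and it is linear if and only if it is isotopic to $x_1\oplus\cdots\oplus x_n$. (ii) Every nonlinear $n$-ary quasigroup $f$ of order $4$ satisfies $|\mathrm{Atp}(f)|\le 2\cdot 4^n$, with equality if and only if $f$ is semilinear and $\mathrm{Atp}(f)$ acts transitively on $M(f)$. If $n\ge 2$, then $2\cdot 4^n$ is the maximum order of the autotopy group of a nonlinear $n$-ary quasigroup of order $4$. -/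

import Mathlib

namespace NQuasigroup

variable {α : Type*} {n : ℕ}

/-- An `n`-ary operation is a quasigroup if it is invertible in each argument. -/
def IsQuasigroup (f : (Fin n → α) → α) : Prop :=
  ∀ (i : Fin n) (x : Fin n → α), Function.Bijective fun a => f (Function.update x i a)

/-- An isotopy `(θ₀, θ₁, …, θₙ)`: `n + 1` permutations, composed componentwise. -/
abbrev Isotopy (n : ℕ) (α : Type*) : Type _ := Fin (n + 1) → Equiv.Perm α

/-- The isotopy action `(x₀, …, xₙ) ↦ (θ₀ x₀, …, θₙ xₙ)`. -/
def Isotopy.act (θ : Isotopy n α) (x : Fin (n + 1) → α) : Fin (n + 1) → α :=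
  fun i => θ i (x i)

/-- `f` and `g` are isotopic if `g (x₁, …, xₙ) = θ₀⁻¹ (f (θ₁ x₁, …, θₙ xₙ))` for some
isotopy `θ`. -/
def Isotopic (f g : (Fin n → α) → α) : Prop :=
  ∃ θ : Isotopy n α, ∀ x, g x = (θ 0)⁻¹ (f fun i => θ i.succ (x i))

/-- The autotopy group of `f`: the isotopies `θ` with
`f (θ₁ x₁, …, θₙ xₙ) = θ₀ (f (x₁, …, xₙ))` for all `x`. -/
def autotopyGroup (f : (Fin n → α) → α) : Subgroup (Isotopy n α) where
  carrier := {θ | ∀ x, (f fun i => θ i.succ (x i)) = θ 0 (f x)}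
  one_mem' := fun _ => rfl
  mul_mem' := by
    intro θ η hθ hη x
    have h := hθ fun i => η i.succ (x i)
    rw [hη x] at h
    exact h
  inv_mem' := by
    intro θ hθ x
    have h := hθ fun i => (θ i.succ).symm (x i)
    simp only [Equiv.apply_symm_apply] at h
    exact (Equiv.symm_apply_eq (θ 0)).mpr h |>.symm

/-- The code `{(x₀, x₁, …, xₙ) | x₀ = f (x₁, …, xₙ)}` of `f`. -/
def code (f : (Fin n → α) → α) : Set (Fin (n + 1) → α) :=
  {x | x 0 = f fun i => x i.succ}

/-- The autotopy group of `f` acts transitively on the code of `f`. -/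
def AutotopyTransitive (f : (Fin n → α) → α) : Prop :=
  ∀ x ∈ code f, ∀ y ∈ code f, ∃ θ ∈ autotopyGroup f, Isotopy.act θ x = y

/-- `a j ≠ b j` for `j = 0, …, n` and
`f ({a₁, b₁} × ⋯ × {aₙ, bₙ}) = {a₀, b₀}`. -/
def SemilinearVia (f : (Fin n → Fin 4) → Fin 4) (a b : Fin (n + 1) → Fin 4) : Prop :=
  (∀ j, a j ≠ b j) ∧
    f '' {x | ∀ i : Fin n, x i = a i.succ ∨ x i = b i.succ} = {a 0, b 0}

/-- `f` is semilinear. -/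
def IsSemilinear (f : (Fin n → Fin 4) → Fin 4) : Prop :=
  ∃ a b, SemilinearVia f a b

/-- `f` is `{c, d}`-semilinear in the `j`-th argument, the `0`-th argument being the value. -/
def SemilinearIn (f : (Fin n → Fin 4) → Fin 4) (j : Fin (n + 1)) (c d : Fin 4) : Prop :=
  ∃ a b, SemilinearVia f a b ∧ ({a j, b j} : Set (Fin 4)) = {c, d}

/-- `f` is linear: `{c, d}`-semilinear in each argument, for all `c ≠ d`. -/
def IsLinear (f : (Fin n → Fin 4) → Fin 4) : Prop :=
  ∀ (j : Fin (n + 1)) (c d : Fin 4), c ≠ d → SemilinearIn f j c d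

/-- `lₙ (x₁, …, xₙ) = x₁ ⊕ ⋯ ⊕ xₙ`, where `⊕` is the bitwise exclusive or on `{0, 1, 2, 3}`
(a copy of `ℤ/2 × ℤ/2`). -/
def xorSum : (n : ℕ) → (Fin n → Fin 4) → Fin 4
  | 0, _ => 0
  | n + 1, x => xorSum n (fun i => x i.castSucc) ^^^ x (Fin.last n)

end NQuasigroup

namespace NQuasigroup

variable {α : Type*} {n : ℕ}

namespace IsQuasigroup

/-! The proof is orbit–stabilizer counting for `autotopyGroup f` acting on the code, which has `4 ^
n` points. An autotopy fixing a point of the code is determined by any one coordinate, so a point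
stabilizer embeds in the symmetric group on three letters and its order divides 6
(`card_pointStabilizer_dvd`).

If 3 divides that order, some autotopy acts as a 3-cycle in the value coordinate. After normalizing
the fixed point to zero it becomes one permutation acting on all coordinates.
`eq_xorSum_of_automorphism` then forces `xorSum`: at a word of minimal support where the two
operations differ, the discrepancy `k` can be carried to a constant word on the same support, and
the 3-cycle carries a different discrepancy to that same word.

Otherwise the stabilizer has order at most 2. An involution in it fixes exactly two symbols in each
coordinate, and these pairs witness semilinearity. Conversely, a semilinear structure can be moved
to any code point, and swapping the complementary pairs gives an involution fixing that point.
Linearity supplies two such involutions at one point whose product is a 3-cycle on values, hence an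
isotopy to `xorSum`. Addition modulo 4 attains the nonlinear bound. -/

lemma update_injective {f : (Fin n → α) → α} (hf : IsQuasigroup f) (i : Fin n)
    (x : Fin n → α) : Function.Injective fun a => f (Function.update x i a) :=
  (hf i x).1

lemma apply_update_ne {f : (Fin n → α) → α} (hf : IsQuasigroup f) {i : Fin n}
    {x : Fin n → α} {a : α} (ha : a ≠ x i) : f (Function.update x i a) ≠ f x := by
  intro h
  apply ha
  apply hf.update_injective i x
  simpa using h

end IsQuasigroup

/-! ### Exclusive or on four symbols -/

lemma fin4_xor_comm : ∀ a b : Fin 4, a ^^^ b = b ^^^ a := by decide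

lemma fin4_xor_zero : ∀ a : Fin 4, a ^^^ 0 = a := by decide

lemma fin4_zero_xor : ∀ a : Fin 4, 0 ^^^ a = a := by decide

lemma fin4_xor_cancel_right : ∀ a b : Fin 4, a ^^^ b ^^^ b = a := by decide

lemma fin4_xor_left_inj : ∀ a b c : Fin 4, a ^^^ c = b ^^^ c ↔ a = b := by decide

lemma xorSum_update (x : Fin n → Fin 4) (i : Fin n) (a : Fin 4) :
    xorSum n (Function.update x i a) = xorSum n x ^^^ x i ^^^ a := by
  induction n with
  | zero => exact i.elim0
  | succ n ih =>
    refine Fin.lastCases ?_ (fun i => ?_) i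
    · have h : (fun j : Fin n => Function.update x (Fin.last n) a j.castSucc)
          = fun j => x j.castSucc := Fin.init_update_last (α := fun _ => Fin 4) x a
      simp only [xorSum, h, Function.update_self]
      rw [fin4_xor_cancel_right]
    · have h : (fun j : Fin n => Function.update x i.castSucc a j.castSucc)
          = Function.update (fun j => x j.castSucc) i a :=
        Fin.init_update_castSucc (α := fun _ => Fin 4) x i a
      have hne : Fin.last n ≠ i.castSucc := (Fin.castSucc_lt_last i).ne'
      simp only [xorSum, h, ih, Function.update_of_ne hne]
      generalize xorSum n _ = s
      generalize x i.castSucc = b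
      generalize x (Fin.last n) = c
      clear * -
      revert s a b c
      decide

lemma xorSum_zero : xorSum n (fun _ => 0) = 0 := by
  induction n with
  | zero => rfl
  | succ n ih => simp only [xorSum, ih]; rfl

lemma xorSum_single (i : Fin n) (a : Fin 4) :
    xorSum n (Function.update (fun _ => 0) i a) = a := by
  rw [xorSum_update, xorSum_zero]
  revert a; decide

/-- The three nonzero elements of the Klein group are interchangeable, so every permutation fixing
zero is an automorphism. -/
lemma perm_xor : ∀ τ : Equiv.Perm (Fin 4), τ 0 = 0 →
    ∀ a b, τ (a ^^^ b) = τ a ^^^ τ b := by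
  decide

lemma xorSum_perm_xor {τ : Equiv.Perm (Fin 4)} (hτ : τ 0 = 0) (x t : Fin n → Fin 4) :
    xorSum n (fun i => τ (x i) ^^^ t i) = τ (xorSum n x) ^^^ xorSum n t := by
  induction n with
  | zero => simp only [xorSum, hτ]; rfl
  | succ n ih =>
    simp only [xorSum, ih, perm_xor τ hτ]
    generalize τ _ = a
    generalize τ _ = b
    generalize xorSum n _ = c
    generalize t _ = d
    revert a b c d
    decide

lemma xorSum_perm {τ : Equiv.Perm (Fin 4)} (hτ : τ 0 = 0) (x : Fin n → Fin 4) :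
    xorSum n (fun i => τ (x i)) = τ (xorSum n x) := by
  have h := xorSum_perm_xor hτ x (fun _ => 0)
  simpa only [xorSum_zero, fin4_xor_zero] using h

lemma isQuasigroup_xorSum : IsQuasigroup (xorSum n) := by
  intro i x
  rw [← Finite.injective_iff_bijective]
  intro a b h
  simp only [xorSum_update] at h
  rw [fin4_xor_comm _ a, fin4_xor_comm _ b, fin4_xor_left_inj] at h
  exact h

/-! ### Latin squares of order 4 and the rigidity of `xorSum` -/

set_option synthInstance.maxSize 2000 in
set_option synthInstance.maxHeartbeats 400000 in
/-- The normalized Latin squares of order `4`. -/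
lemma normalized_latin_square (L : Fin 4 → Fin 4 → Fin 4) (h0 : ∀ a, L a 0 = a)
    (h0' : ∀ b, L 0 b = b) (hr : ∀ a, Function.Injective (L a))
    (hc : ∀ b, Function.Injective fun a => L a b) :
    ∃ k, ∀ a b, L a b = a ^^^ b ^^^ (if a = 0 ∨ a = k ∨ b = 0 ∨ b = k then 0 else k) := by
  -- There are four such squares: `k = 0` is the Klein group, and `k ≠ 0` is the cyclic group whose
  -- involution is `k`. Each entry is followed at once by its exclusions, so the enumeration prunes
  -- early.
  have key : ∀ p : Fin 4, p ≠ 1 → ∀ q : Fin 4, q ≠ 1 → q ≠ 2 → q ≠ p →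
      ∀ r : Fin 4, r ≠ 1 → r ≠ 3 → r ≠ p → r ≠ q →
      ∀ p' : Fin 4, p' ≠ 2 → p' ≠ 1 → p' ≠ p → ∀ q' : Fin 4, q' ≠ 2 → q' ≠ q → q' ≠ p' →
      ∀ r' : Fin 4, r' ≠ 2 → r' ≠ 3 → r' ≠ r → r' ≠ p' → r' ≠ q' →
      ∀ p'' : Fin 4, p'' ≠ 3 → p'' ≠ 1 → p'' ≠ p → p'' ≠ p' →
      ∀ q'' : Fin 4, q'' ≠ 3 → q'' ≠ 2 → q'' ≠ q → q'' ≠ q' → q'' ≠ p'' →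
      ∀ r'' : Fin 4, r'' ≠ 3 → r'' ≠ r → r'' ≠ r' → r'' ≠ p'' → r'' ≠ q'' →
      ∃ k : Fin 4, ∀ a b : Fin 4,
        (![![0, 1, 2, 3], ![1, p, q, r], ![2, p', q', r'], ![3, p'', q'', r'']] :
          Fin 4 → Fin 4 → Fin 4) a b =
        a ^^^ b ^^^ (if a = 0 ∨ a = k ∨ b = 0 ∨ b = k then 0 else k) := by
    decide +kernel
  have r1 : ∀ a b c : Fin 4, b ≠ c → L a b ≠ L a c := fun a b c h => (hr a).ne h
  have c1 : ∀ a b c : Fin 4, a ≠ b → L a c ≠ L b c := fun a b c h => (hc c).ne h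
  have rz : ∀ a b : Fin 4, b ≠ 0 → L a b ≠ a := fun a b h => by
    have := r1 a b 0 h; rwa [h0] at this
  have cz : ∀ a b : Fin 4, a ≠ 0 → L a b ≠ b := fun a b h => by
    have := c1 a 0 b h; rwa [h0'] at this
  obtain ⟨k, hk⟩ := key (L 1 1) (rz _ _ (by decide))
    (L 1 2) (rz _ _ (by decide)) (cz _ _ (by decide)) (r1 _ _ _ (by decide))
    (L 1 3) (rz _ _ (by decide)) (cz _ _ (by decide)) (r1 _ _ _ (by decide)) (r1 _ _ _ (by decide))
    (L 2 1) (rz _ _ (by decide)) (cz _ _ (by decide)) (c1 _ _ _ (by decide))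
    (L 2 2) (rz _ _ (by decide)) (c1 _ _ _ (by decide)) (r1 _ _ _ (by decide))
    (L 2 3) (rz _ _ (by decide)) (cz _ _ (by decide)) (c1 _ _ _ (by decide)) (r1 _ _ _ (by decide))
      (r1 _ _ _ (by decide))
    (L 3 1) (rz _ _ (by decide)) (cz _ _ (by decide)) (c1 _ _ _ (by decide)) (c1 _ _ _ (by decide))
    (L 3 2) (rz _ _ (by decide)) (cz _ _ (by decide)) (c1 _ _ _ (by decide)) (c1 _ _ _ (by decide))
      (r1 _ _ _ (by decide))
    (L 3 3) (rz _ _ (by decide)) (c1 _ _ _ (by decide)) (c1 _ _ _ (by decide))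
      (r1 _ _ _ (by decide)) (r1 _ _ _ (by decide))
  refine ⟨k, fun a b => ?_⟩
  rw [← hk]
  fin_cases a <;> fin_cases b <;> simp [h0, h0']

/-- The support of a word. -/
def supp (x : Fin n → Fin 4) : Finset (Fin n) := {i | x i ≠ 0}

lemma mem_supp {x : Fin n → Fin 4} {i : Fin n} : i ∈ supp x ↔ x i ≠ 0 := by simp [supp]

/-- If `g` agrees with `xorSum` on the words with smaller support than `y`, then a nonzero
discrepancy at `y` propagates along the lines through `y`. -/
lemma discrepancy_update {g : (Fin n → Fin 4) → Fin 4} (hg : IsQuasigroup g)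
    {y : Fin n → Fin 4} (H : ∀ z, (supp z).card < (supp y).card → g z = xorSum n z)
    {i j : Fin n} (hij : i ≠ j) (hi : y i ≠ 0) (hj : y j ≠ 0) {k : Fin 4} (hk : k ≠ 0)
    (hy : g y = xorSum n y ^^^ k) :
    y i ≠ k ∧ ∀ c, c ≠ 0 → c ≠ k →
      g (Function.update y i c) = xorSum n (Function.update y i c) ^^^ k := by
  set w : Fin 4 → Fin 4 → Fin n → Fin 4 :=
    fun a b => Function.update (Function.update y i a) j b with hw
  set s := xorSum n (w 0 0) with hs
  have hws : ∀ a b, xorSum n (w a b) = s ^^^ a ^^^ b := by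
    intro a b
    simp only [hs, hw, xorSum_update, Function.update_of_ne hij.symm]
    generalize xorSum n y = p
    generalize y i = q
    generalize y j = r
    revert a b p q r
    decide
  -- Zeroing coordinate `i` or `j` shrinks the support, so the border of this square is known and
  -- the square is normalized after translation by `s`.
  have hsmall : ∀ a b, a = 0 ∨ b = 0 → g (w a b) = s ^^^ a ^^^ b := by
    intro a b hab
    rw [← hws]
    apply H
    apply Finset.card_lt_card
    rw [Finset.ssubset_iff_of_subset]
    · rcases hab with rfl | rfl
      · exact ⟨i, mem_supp.2 hi, by simp [mem_supp, hw, Function.update_of_ne hij]⟩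
      · exact ⟨j, mem_supp.2 hj, by simp [mem_supp, hw]⟩
    · intro l hl
      rw [mem_supp] at hl ⊢
      by_cases hlj : l = j
      · rwa [hlj]
      · by_cases hli : l = i
        · rwa [hli]
        · simpa [hw, hlj, hli] using hl
  have hcomm : ∀ a b, w a b = Function.update (Function.update y j b) i a := fun a b =>
    Function.update_comm hij a b y
  obtain ⟨k', hk'⟩ := normalized_latin_square (fun a b => g (w a b) ^^^ s)
    (fun a => by
      rw [hsmall a 0 (Or.inr rfl)]
      revert a; generalize s = s; revert s; decide)
    (fun b => by
      rw [hsmall 0 b (Or.inl rfl)]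
      revert b; generalize s = s; revert s; decide)
    (fun a b c h => hg.update_injective j _ ((fin4_xor_left_inj _ _ _).1 h))
    (fun b a c h => by
      have h' := (fin4_xor_left_inj _ _ _).1 h
      rw [hcomm, hcomm] at h'
      exact hg.update_injective i _ h')
  have hyw : y = w (y i) (y j) := by simp [hw]
  have hcw : ∀ c, Function.update y i c = w c (y j) := by
    intro c; rw [hcomm]; simp
  have e1 := hk' (y i) (y j)
  rw [← hyw, hy] at e1
  have e2 := hws (y i) (y j)
  rw [← hyw] at e2
  rw [e2] at e1
  -- A nonzero discrepancy at the entry `(y i, y j)` identifies the square: it is the cyclic one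
  -- with parameter `k`, and both indices lie outside `{0, k}`.
  have e3 : k' = k ∧ y i ≠ k ∧ y j ≠ k := by
    clear hk'
    clear_value s
    clear e2 hsmall hws hcomm hyw hcw hw hy H
    generalize y i = a at *
    generalize y j = b at *
    clear w hs
    revert s a b k k'
    decide +kernel
  obtain ⟨rfl, h4, h5⟩ := e3
  refine ⟨h4, fun c hc0 hck => ?_⟩
  have e4 := hk' c (y j)
  rw [hcw, hws]
  rw [if_neg (by tauto)] at e4
  generalize g (w c (y j)) = A at *
  rw [← fin4_xor_left_inj _ _ s, e4]
  generalize s = s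
  generalize y j = b
  clear * -
  revert c b s k'
  decide +kernel

/-- The nonzero coordinates are replaced by `c` one at a time. The support never changes, so
`discrepancy_update` applies at each step; two support elements are needed to have a second
direction. -/
lemma discrepancy_const {g : (Fin n → Fin 4) → Fin 4} (hg : IsQuasigroup g)
    {x : Fin n → Fin 4} (H : ∀ z, (supp z).card < (supp x).card → g z = xorSum n z)
    (hx : 2 ≤ (supp x).card) {k c : Fin 4} (hk : k ≠ 0) (hc0 : c ≠ 0) (hck : c ≠ k)
    (hxk : g x = xorSum n x ^^^ k) :
    g (fun i => if x i = 0 then 0 else c) =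
      xorSum n (fun i => if x i = 0 then 0 else c) ^^^ k := by
  have key : ∀ T : Finset (Fin n),
      g (fun i => if i ∈ T ∧ x i ≠ 0 then c else x i) =
        xorSum n (fun i => if i ∈ T ∧ x i ≠ 0 then c else x i) ^^^ k := by
    intro T
    induction T using Finset.induction_on with
    | empty => simpa using hxk
    | insert i T hi ih =>
      by_cases h0 : x i = 0
      · have : (fun l => if l ∈ insert i T ∧ x l ≠ 0 then c else x l) =
            fun l => if l ∈ T ∧ x l ≠ 0 then c else x l := by
          funext l
          by_cases hl : l = i
          · subst hl; simp [h0]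
          · simp [hl]
        rw [this]; exact ih
      · set z : Fin n → Fin 4 := fun l => if l ∈ T ∧ x l ≠ 0 then c else x l with hz
        have hzs : supp z = supp x := by
          ext l
          simp only [mem_supp, hz]
          by_cases hl : l ∈ T ∧ x l ≠ 0
          · simp [hl, hc0]
          · simp [hl]
        have hup : (fun l => if l ∈ insert i T ∧ x l ≠ 0 then c else x l) =
            Function.update z i c := by
          funext l
          by_cases hl : l = i
          · subst hl; simp [h0]
          · simp [hl, hz]
        rw [hup]
        obtain ⟨j, hj, hji⟩ := Finset.exists_mem_ne hx i
        rw [← hzs, mem_supp] at hj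
        refine (discrepancy_update hg (y := z) (by rwa [hzs]) hji.symm ?_ hj hk ih).2 c hc0 hck
        simpa [hz, hi] using h0
  have h := key Finset.univ
  have e : (fun i => if i ∈ Finset.univ ∧ x i ≠ 0 then c else x i) =
      fun i => if x i = 0 then 0 else c := by
    funext i
    by_cases h0 : x i = 0 <;> simp [h0]
  rwa [e] at h

/-- A normalized quasigroup of order `4` with an automorphism of order `3` is `xorSum`. -/
lemma eq_xorSum_of_automorphism (hn : 1 ≤ n) {g : (Fin n → Fin 4) → Fin 4}
    (hg : IsQuasigroup g) (hnorm : ∀ i a, g (Function.update (fun _ => 0) i a) = a)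
    {τ : Equiv.Perm (Fin 4)} (hτ : ∀ a, τ a = a ↔ a = 0)
    (hgτ : ∀ x, (g fun i => τ (x i)) = τ (g x)) : g = xorSum n := by
  have hτ0 : τ 0 = 0 := (hτ 0).2 rfl
  suffices h : ∀ m, ∀ x, (supp x).card = m → g x = xorSum n x from funext fun x => h _ x rfl
  intro m
  induction m using Nat.strong_induction_on with
  | _ m IH =>
  intro x hx
  have H : ∀ z, (supp z).card < (supp x).card → g z = xorSum n z := fun z hz =>
    IH _ (hx ▸ hz) z rfl
  rcases lt_or_ge (supp x).card 2 with h2 | h2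
  · obtain ⟨i, hi⟩ : ∃ i : Fin n, ∀ j, j ≠ i → x j = 0 := by
      rcases Finset.eq_empty_or_nonempty (supp x) with he | ⟨i, hi⟩
      · refine ⟨⟨0, hn⟩, fun j _ => ?_⟩
        by_contra hj
        exact absurd (mem_supp.2 hj) (by simp [he])
      · refine ⟨i, fun j hj => ?_⟩
        by_contra hj0
        exact hj (Finset.card_le_one.1 (by omega) j (mem_supp.2 hj0) i hi)
    have e : x = Function.update (fun _ => 0) i (x i) := by
      funext j
      by_cases hj : j = i
      · subst hj; simp
      · simp [hj, hi j hj]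
    rw [e, hnorm, xorSum_single]
  · by_contra hne
    obtain ⟨k, hk⟩ : ∃ k, g x = xorSum n x ^^^ k := ⟨xorSum n x ^^^ g x, by
      generalize xorSum n x = a
      generalize g x = b
      revert a b; decide⟩
    have hk0 : k ≠ 0 := by
      rintro rfl
      exact hne (by rw [hk, fin4_xor_zero])
    have hτk : τ k ≠ k := fun h => hk0 ((hτ k).1 h)
    have hτk0 : τ k ≠ 0 := fun h => hk0 (τ.injective (h.trans hτ0.symm))
    -- Among four symbols one avoids `0`, `k` and `τ k`. The constant word built from it receives
    -- discrepancy `k` from `x` and `τ k` from the image of `x`.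
    obtain ⟨c, hc0, hck, hcτ⟩ : ∃ c : Fin 4, c ≠ 0 ∧ c ≠ k ∧ c ≠ τ k := by
      generalize τ k = l
      clear * -
      revert k l; decide
    have hs : supp (fun i => τ (x i)) = supp x := by
      ext i
      simp only [mem_supp]
      rw [not_iff_not]
      exact ⟨fun h => τ.injective (h.trans hτ0.symm), fun h => by rw [h, hτ0]⟩
    have h1 := discrepancy_const hg H h2 hk0 hc0 hck hk
    have h3 := discrepancy_const hg (x := fun i => τ (x i)) (by rwa [hs]) (by rwa [hs])
      hτk0 hc0 hcτ (by rw [hgτ, hk, perm_xor τ hτ0, xorSum_perm hτ0])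
    have e : (fun i => if τ (x i) = 0 then 0 else c) = fun i => if x i = 0 then 0 else c := by
      funext i
      congr 1
      exact propext ⟨fun h => τ.injective (h.trans hτ0.symm), fun h => by rw [h, hτ0]⟩
    rw [e, h1, fin4_xor_comm, fin4_xor_comm _ (τ k), fin4_xor_left_inj] at h3
    exact hτk h3.symm

/-! ### Orbits and point stabilizers -/

lemma perm_apply_inv_self (σ : Equiv.Perm α) (a : α) : σ (σ⁻¹ a) = a := σ.apply_symm_apply a

lemma perm_inv_apply_self (σ : Equiv.Perm α) (a : α) : σ⁻¹ (σ a) = a := σ.symm_apply_apply a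

/-- Lines through a fixed point are preserved, so each such line conjugates `θ i.succ` into `θ 0`;
this makes one coordinate determine all the others. -/
lemma autotopy_apply_update {f : (Fin n → α) → α} {θ : Isotopy n α}
    (hθ : θ ∈ autotopyGroup f) {x : Fin n → α} (hx : ∀ i, θ i.succ (x i) = x i) (i : Fin n)
    (a : α) : θ 0 (f (Function.update x i a)) = f (Function.update x i (θ i.succ a)) := by
  rw [← hθ]
  congr 1
  funext j
  by_cases h : j = i
  · subst h; simp
  · simp [h, hx]

lemma autotopy_zero_eq_one_iff {f : (Fin n → α) → α} (hf : IsQuasigroup f) {θ : Isotopy n α}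
    (hθ : θ ∈ autotopyGroup f) {x : Fin n → α} (hx : ∀ i, θ i.succ (x i) = x i) (i : Fin n) :
    θ 0 = 1 ↔ θ i.succ = 1 := by
  constructor
  · intro h
    ext a
    apply hf.update_injective i x
    have := autotopy_apply_update hθ hx i a
    rw [h] at this
    exact this.symm
  · intro h
    ext b
    obtain ⟨a, rfl⟩ := (hf i x).2 b
    have := autotopy_apply_update hθ hx i a
    rw [h] at this
    exact this

lemma autotopy_eq_one_iff {f : (Fin n → α) → α} (hf : IsQuasigroup f) {θ : Isotopy n α}
    (hθ : θ ∈ autotopyGroup f) {x : Fin n → α} (hx : ∀ i, θ i.succ (x i) = x i)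
    (j : Fin (n + 1)) (hj : θ j = 1) : θ = 1 := by
  have h0 : θ 0 = 1 := by
    refine Fin.cases (fun h => h) (fun i h => ?_) j hj
    exact (autotopy_zero_eq_one_iff hf hθ hx i).2 h
  funext l
  refine Fin.cases h0 (fun i => ?_) l
  exact (autotopy_zero_eq_one_iff hf hθ hx i).1 h0

/-- The stabilizer of a point in the autotopy group. -/
abbrev pointStabilizer (f : (Fin n → α) → α) (p : Fin (n + 1) → α) :
    Subgroup (autotopyGroup f) :=
  MulAction.stabilizer (autotopyGroup f) p

lemma mem_pointStabilizer {f : (Fin n → α) → α} {p : Fin (n + 1) → α} {θ : autotopyGroup f} :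
    θ ∈ pointStabilizer f p ↔ ∀ j, θ.1 j (p j) = p j := by
  rw [MulAction.mem_stabilizer_iff]
  exact funext_iff

lemma orbit_subset_code {f : (Fin n → α) → α} {p : Fin (n + 1) → α} (hp : p ∈ code f) :
    MulAction.orbit (autotopyGroup f) p ⊆ code f := by
  rintro _ ⟨θ, rfl⟩
  change θ.1 0 (p 0) = f fun i => θ.1 i.succ (p i.succ)
  rw [hp, ← θ.2]

lemma ncard_code (f : (Fin n → Fin 4) → Fin 4) : (code f).ncard = 4 ^ n := by
  have h : code f =
      Set.range fun x : Fin n → Fin 4 => (Fin.cons (f x) x : Fin (n + 1) → Fin 4) := by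
    ext p
    constructor
    · intro hp
      refine ⟨fun i => p i.succ, funext fun j => ?_⟩
      exact Fin.cases hp.symm (fun _ => rfl) j
    · rintro ⟨x, rfl⟩
      simp [code]
  have hinj : Function.Injective
      fun x : Fin n → Fin 4 => (Fin.cons (f x) x : Fin (n + 1) → Fin 4) := by
    intro x y hxy
    funext i
    exact congrFun hxy i.succ
  rw [h, ← Set.image_univ, Set.ncard_image_of_injective _ hinj]
  simp

lemma card_autotopyGroup (f : (Fin n → Fin 4) → Fin 4) (p : Fin (n + 1) → Fin 4) :
    Nat.card (autotopyGroup f) =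
      Nat.card (pointStabilizer f p) * (MulAction.orbit (autotopyGroup f) p).ncard := by
  rw [← MulAction.index_stabilizer, Subgroup.card_mul_index]

lemma card_autotopyGroup_le (f : (Fin n → Fin 4) → Fin 4) {p : Fin (n + 1) → Fin 4}
    (hp : p ∈ code f) : Nat.card (autotopyGroup f) ≤ Nat.card (pointStabilizer f p) * 4 ^ n := by
  rw [card_autotopyGroup f p, ← ncard_code f]
  exact Nat.mul_le_mul_left _ (Set.ncard_le_ncard (orbit_subset_code hp) (Set.toFinite _))

lemma orbit_eq_code_iff {f : (Fin n → Fin 4) → Fin 4} {p : Fin (n + 1) → Fin 4}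
    (hp : p ∈ code f) : MulAction.orbit (autotopyGroup f) p = code f ↔ AutotopyTransitive f := by
  constructor
  · intro h x hx y hy
    rw [← h] at hx hy
    obtain ⟨θ, rfl⟩ := hx
    obtain ⟨η, rfl⟩ := hy
    refine ⟨η.1 * θ.1⁻¹, mul_mem η.2 (inv_mem θ.2), ?_⟩
    funext j
    simp [Isotopy.act, Subgroup.smul_def]
  · intro h
    refine Set.Subset.antisymm (orbit_subset_code hp) fun y hy => ?_
    obtain ⟨θ, hθ, rfl⟩ := h p hp y hy
    exact ⟨⟨θ, hθ⟩, rfl⟩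

lemma card_pointStabilizer_dvd {f : (Fin n → Fin 4) → Fin 4} (hf : IsQuasigroup f)
    {p : Fin (n + 1) → Fin 4} : Nat.card (pointStabilizer f p) ∣ 6 := by
  have h6 : Nat.card (MulAction.stabilizer (Equiv.Perm (Fin 4)) (p 0)) = 6 := by
    have h := Subgroup.card_mul_index (MulAction.stabilizer (Equiv.Perm (Fin 4)) (p 0))
    rw [MulAction.index_stabilizer, MulAction.orbit_eq_univ, Set.ncard_univ, Nat.card_perm,
      Nat.card_fin, show Nat.factorial 4 = 24 from rfl] at h
    omega
  let φ : pointStabilizer f p →* MulAction.stabilizer (Equiv.Perm (Fin 4)) (p 0) :=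
    { toFun := fun θ => ⟨θ.1.1 0, mem_pointStabilizer.1 θ.2 0⟩
      map_one' := rfl
      map_mul' := fun _ _ => rfl }
  rw [← h6]
  refine Subgroup.card_dvd_of_injective φ ((injective_iff_map_eq_one φ).2 fun θ hθ => ?_)
  have h1 := autotopy_eq_one_iff hf θ.1.2
    (fun i => mem_pointStabilizer.1 θ.2 i.succ) 0 (congrArg Subtype.val hθ)
  exact Subtype.ext (Subtype.ext h1)

/-! ### Autotopies of order 3 and isotopy to `xorSum` -/

/-- Normalization of a quasigroup of order `4` at a point. -/
lemma exists_normalizing_isotopy {f : (Fin n → Fin 4) → Fin 4} (hf : IsQuasigroup f)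
    (y : Fin n → Fin 4) : ∃ φ : Isotopy n (Fin 4), φ 0 0 = f y ∧ (∀ i : Fin n, φ i.succ 0 = y i) ∧
      ∀ i a, f (Function.update y i (φ i.succ a)) = φ 0 a := by
  let s := Equiv.swap 0 (f y)
  let φ : Fin n → Equiv.Perm (Fin 4) := fun i => s.trans (Equiv.ofBijective _ (hf i y)).symm
  have h : ∀ i a, f (Function.update y i (φ i a)) = s a := fun i a =>
    (Equiv.ofBijective _ (hf i y)).apply_symm_apply (s a)
  refine ⟨Fin.cons s φ, Equiv.swap_apply_left _ _, fun i => ?_, h⟩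
  apply hf.update_injective i y
  simp only [Fin.cons_succ, h, Function.update_eq_self]
  exact Equiv.swap_apply_left _ _

lemma isotopic_quasigroup {f g : (Fin n → Fin 4) → Fin 4} (hf : IsQuasigroup f)
    (h : Isotopic f g) : IsQuasigroup g := by
  obtain ⟨θ, hθ⟩ := h
  intro i x
  rw [← Finite.injective_iff_bijective]
  intro a b hab
  simp only [hθ] at hab
  have e : ∀ a, (fun j => θ j.succ (Function.update x i a j)) =
      Function.update (fun j => θ j.succ (x j)) i (θ i.succ a) := by
    intro a
    funext j
    by_cases hj : j = i
    · subst hj; simp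
    · simp [hj]
  rw [e, e] at hab
  exact (θ i.succ).injective (hf.update_injective i _ ((θ 0)⁻¹.injective hab))

/-- A quasigroup of order `4` with an autotopy that fixes a point of the code and no other
value is isotopic to `xorSum`. -/
lemma isotopic_xorSum_of_autotopy (hn : 1 ≤ n) {f : (Fin n → Fin 4) → Fin 4}
    (hf : IsQuasigroup f) {y : Fin n → Fin 4} {θ : Isotopy n (Fin 4)}
    (hθ : θ ∈ autotopyGroup f) (hy : ∀ i, θ i.succ (y i) = y i)
    (h0 : ∀ a, θ 0 a = a ↔ a = f y) : Isotopic f (xorSum n) := by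
  obtain ⟨φ, hφ0, hφy, hφ⟩ := exists_normalizing_isotopy hf y
  refine ⟨φ, ?_⟩
  set g : (Fin n → Fin 4) → Fin 4 := fun x => (φ 0)⁻¹ (f fun i => φ i.succ (x i)) with hg
  have hgq : IsQuasigroup g := isotopic_quasigroup hf ⟨φ, fun _ => rfl⟩
  suffices h : g = xorSum n from fun x => (congrFun h x).symm
  -- Normalized lines are identities, so conjugation by `φ` turns every component of `θ` into the
  -- same permutation.
  have hτi : ∀ (i : Fin n) (a : Fin 4), (φ 0)⁻¹ (θ 0 (φ 0 a)) = (φ i.succ)⁻¹ (θ i.succ (φ i.succ a)) := by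
    intro i a
    have h1 := autotopy_apply_update hθ hy i (φ i.succ a)
    have h2 := hφ i ((φ i.succ)⁻¹ (θ i.succ (φ i.succ a)))
    rw [perm_apply_inv_self, ← h1, hφ] at h2
    rw [h2, perm_inv_apply_self]
  refine eq_xorSum_of_automorphism hn hgq (fun i a => ?_) (τ := (φ 0)⁻¹ * θ 0 * φ 0)
    (fun a => ?_) (fun x => ?_)
  · simp only [hg]
    rw [Equiv.Perm.inv_eq_iff_eq, ← hφ i]
    congr 1
    funext j
    by_cases hj : j = i
    · subst hj; simp
    · simp [hj, hφy]
  · simp only [Equiv.Perm.mul_apply, Equiv.Perm.inv_eq_iff_eq]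
    rw [eq_comm (b := φ 0 a), eq_comm, h0, ← hφ0, (φ 0).injective.eq_iff]
  · simp only [Equiv.Perm.mul_apply, hg, perm_apply_inv_self]
    rw [← hθ]
    congr 2
    funext i
    rw [hτi, perm_apply_inv_self]

lemma isotopic_xorSum_of_three_dvd (hn : 1 ≤ n) {f : (Fin n → Fin 4) → Fin 4}
    (hf : IsQuasigroup f) {p : Fin (n + 1) → Fin 4} (hp : p ∈ code f)
    (h3 : 3 ∣ Nat.card (pointStabilizer f p)) : Isotopic f (xorSum n) := by
  have : Fact (Nat.Prime 3) := ⟨Nat.prime_three⟩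
  obtain ⟨θ, hθ⟩ := exists_prime_orderOf_dvd_card' 3 h3
  have hfix := mem_pointStabilizer.1 θ.2
  have hpow : θ ^ 3 = 1 := hθ ▸ pow_orderOf_eq_one θ
  have hpow0 : θ.1.1 0 ^ 3 = 1 := by
    have := congrArg (fun η : pointStabilizer f p => η.1.1 0) hpow
    simpa using this
  have hne : θ.1.1 0 ≠ 1 := by
    intro h
    have h1 := autotopy_eq_one_iff hf θ.1.2 (fun i => hfix i.succ) 0 h
    have : θ = 1 := Subtype.ext (Subtype.ext h1)
    rw [this, orderOf_one] at hθ
    omega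
  refine isotopic_xorSum_of_autotopy hn hf θ.1.2 (fun i => hfix i.succ) fun a => ?_
  rw [← show p 0 = f fun i => p i.succ from hp]
  -- A nontrivial permutation of four points with cube 1 is a 3-cycle, hence has a single fixed
  -- point.
  have key : ∀ σ : Equiv.Perm (Fin 4), σ ^ 3 = 1 → σ ≠ 1 → ∀ b, σ b = b →
      ∀ a, σ a = a ↔ a = b := by decide +kernel
  exact key _ hpow0 hne _ (hfix 0) a

/-! ### Bounds on the order and isotopy invariance -/

lemma card_le_six_mul {f : (Fin n → Fin 4) → Fin 4} (hf : IsQuasigroup f) :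
    Nat.card (autotopyGroup f) ≤ 6 * 4 ^ n := by
  let p : Fin (n + 1) → Fin 4 := Fin.cons (f 0) 0
  have hp : p ∈ code f := rfl
  refine (card_autotopyGroup_le f hp).trans (Nat.mul_le_mul_right _ ?_)
  exact Nat.le_of_dvd (by norm_num) (card_pointStabilizer_dvd hf)

lemma card_pointStabilizer_le_two (hn : 1 ≤ n) {f : (Fin n → Fin 4) → Fin 4}
    (hf : IsQuasigroup f) (hx : ¬ Isotopic f (xorSum n)) {p : Fin (n + 1) → Fin 4}
    (hp : p ∈ code f) : Nat.card (pointStabilizer f p) ≤ 2 := by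
  have h3 : ¬ 3 ∣ Nat.card (pointStabilizer f p) := fun h =>
    hx (isotopic_xorSum_of_three_dvd hn hf hp h)
  have h6 := card_pointStabilizer_dvd hf (p := p)
  generalize Nat.card (pointStabilizer f p) = m at *
  have := Nat.le_of_dvd (by norm_num) h6
  interval_cases m <;> omega

/-- The maps `a ↦ σ a ^^^ t i`, with `σ` fixing zero and `t` arbitrary, give `6 * 4 ^ n` distinct
autotopies. -/
lemma six_mul_le_card_xorSum (hn : 1 ≤ n) :
    6 * 4 ^ n ≤ Nat.card (autotopyGroup (xorSum n)) := by
  let S := {σ : Equiv.Perm (Fin 4) // σ 0 = 0}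
  have hS : Nat.card S = 6 := by
    rw [Nat.card_eq_fintype_card]; decide
  have hc : Nat.card (S × (Fin n → Fin 4)) = 6 * 4 ^ n := by
    rw [Nat.card_prod, hS]; simp
  rw [← hc]
  have hinv : ∀ c : Fin 4, Function.Involutive fun a => a ^^^ c := fun c a => by
    exact fin4_xor_cancel_right a c
  let T : Fin 4 → Equiv.Perm (Fin 4) := fun c => (hinv c).toPerm
  have hT : ∀ c a, T c a = a ^^^ c := fun _ _ => rfl
  let F : S × (Fin n → Fin 4) → autotopyGroup (xorSum n) := fun q =>
    ⟨Fin.cons (T (xorSum n q.2) * q.1.1) fun i => T (q.2 i) * q.1.1, fun x => by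
      simp only [Fin.cons_succ, Fin.cons_zero, Equiv.Perm.mul_apply, hT]
      exact xorSum_perm_xor q.1.2 x q.2⟩
  refine Nat.card_le_card_of_injective F ?_
  rintro ⟨σ, t⟩ ⟨σ', t'⟩ h
  have h' := congrArg Subtype.val h
  have hi : ∀ i a, σ.1 a ^^^ t i = σ'.1 a ^^^ t' i := fun i a =>
    Equiv.congr_fun (congrFun h' i.succ) a
  have ht : t = t' := by
    funext i
    have := hi i 0
    rwa [σ.2, σ'.2, fin4_zero_xor, fin4_zero_xor] at this
  subst ht
  have hσ : σ = σ' := by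
    refine Subtype.ext (Equiv.ext fun a => ?_)
    exact (fin4_xor_left_inj _ _ _).1 (hi ⟨0, hn⟩ a)
  rw [hσ]

lemma card_le_card_of_isotopic {f g : (Fin n → Fin 4) → Fin 4} (h : Isotopic f g) :
    Nat.card (autotopyGroup g) ≤ Nat.card (autotopyGroup f) := by
  obtain ⟨φ, hφ⟩ := h
  refine Nat.card_le_card_of_injective (fun η : autotopyGroup g => (⟨φ * η.1 * φ⁻¹, fun x => ?_⟩ :
    autotopyGroup f)) ?_
  · have h1 := η.2 fun i => (φ i.succ)⁻¹ (x i)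
    rw [hφ, hφ] at h1
    simp only [perm_apply_inv_self] at h1
    rw [Equiv.Perm.inv_eq_iff_eq] at h1
    exact h1
  · intro η η' h
    have h' : φ * η.1 * φ⁻¹ = φ * η'.1 * φ⁻¹ := congrArg Subtype.val h
    exact Subtype.ext (mul_left_cancel (mul_right_cancel h'))

/-! ### Semilinear structures and their involutions -/

/-- One inclusion suffices: changing a single argument within its pair changes the value, so both
values occur. This needs at least one argument. -/
lemma semilinearVia_of_forall (hn : 1 ≤ n) {f : (Fin n → Fin 4) → Fin 4}
    (hf : IsQuasigroup f) {a b : Fin (n + 1) → Fin 4} (hab : ∀ j, a j ≠ b j)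
    (h : ∀ x : Fin n → Fin 4, (∀ i, x i = a i.succ ∨ x i = b i.succ) → f x = a 0 ∨ f x = b 0) :
    SemilinearVia f a b := by
  refine ⟨hab, Set.Subset.antisymm ?_ ?_⟩
  · rintro _ ⟨x, hx, rfl⟩
    exact h x hx
  · let i : Fin n := ⟨0, hn⟩
    let u : Fin n → Fin 4 := fun l => a l.succ
    let v : Fin n → Fin 4 := Function.update u i (b i.succ)
    have hu : ∀ l, u l = a l.succ ∨ u l = b l.succ := fun l => Or.inl rfl
    have hv : ∀ l, v l = a l.succ ∨ v l = b l.succ := by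
      intro l
      by_cases hl : l = i
      · subst hl; right; simp [v]
      · left; simp [v, hl, u]
    have hne : f v ≠ f u := hf.apply_update_ne (hab i.succ).symm
    rintro c hc
    have hfu := h u hu
    have hfv := h v hv
    have : c = f u ∨ c = f v := by
      rcases hc with rfl | rfl <;> grind
    rcases this with rfl | rfl
    · exact ⟨u, hu, rfl⟩
    · exact ⟨v, hv, rfl⟩

set_option synthInstance.maxHeartbeats 200000 in
set_option synthInstance.maxSize 2000 in
lemma fin4_not_pair : ∀ p q u v w : Fin 4, p ≠ q → u ≠ v → u ≠ w → v ≠ w →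
    ((u = p ∨ u = q) ↔ (v = p ∨ v = q)) → ((w = p ∨ w = q) ↔ ¬ (u = p ∨ u = q)) := by
  decide +kernel

lemma SemilinearVia.apply_mem {f : (Fin n → Fin 4) → Fin 4} {a b : Fin (n + 1) → Fin 4}
    (h : SemilinearVia f a b) {x : Fin n → Fin 4}
    (hx : ∀ i, x i = a i.succ ∨ x i = b i.succ) : f x = a 0 ∨ f x = b 0 := by
  have : f x ∈ ({a 0, b 0} : Set (Fin 4)) := h.2 ▸ ⟨x, hx, rfl⟩
  exact this

/-- The value lies in the distinguished class if and only if the number of arguments outside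
their distinguished classes is even. -/
lemma SemilinearVia.apply_mem_iff_even {f : (Fin n → Fin 4) → Fin 4} (hf : IsQuasigroup f)
    {a b : Fin (n + 1) → Fin 4} (h : SemilinearVia f a b) (x : Fin n → Fin 4) :
    (f x = a 0 ∨ f x = b 0) ↔
      Even (Finset.univ.filter fun i => ¬ (x i = a i.succ ∨ x i = b i.succ)).card := by
  generalize hm : (Finset.univ.filter fun i => ¬ (x i = a i.succ ∨ x i = b i.succ)).card = m
  induction m generalizing x with
  | zero =>
    have hx : ∀ i, x i = a i.succ ∨ x i = b i.succ := by
      simpa only [Finset.card_eq_zero, Finset.filter_eq_empty_iff, Finset.mem_univ, not_not,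
        true_imp_iff] using hm
    simp [h.apply_mem hx]
  | succ m ih =>
    obtain ⟨i, hi⟩ : (Finset.univ.filter
        fun i => ¬ (x i = a i.succ ∨ x i = b i.succ)).Nonempty := by
      rw [← Finset.card_pos, hm]; omega
    have hxi := (Finset.mem_filter.1 hi).2
    have hcard : ∀ c, c = a i.succ ∨ c = b i.succ → (Finset.univ.filter fun l =>
        ¬ (Function.update x i c l = a l.succ ∨ Function.update x i c l = b l.succ)).card = m := by
      intro c hc
      have e : (Finset.univ.filter fun l =>
          ¬ (Function.update x i c l = a l.succ ∨ Function.update x i c l = b l.succ)) =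
          (Finset.univ.filter fun i => ¬ (x i = a i.succ ∨ x i = b i.succ)).erase i := by
        ext l
        by_cases hl : l = i
        · subst hl; rcases hc with rfl | rfl <;> simp
        · simp [hl]
      rw [e, Finset.card_erase_of_mem hi, hm, Nat.add_sub_cancel]
    have hu := ih _ (hcard _ (Or.inl rfl))
    have hv := ih _ (hcard _ (Or.inr rfl))
    have huv : f (Function.update x i (a i.succ)) ≠ f (Function.update x i (b i.succ)) :=
      fun e => h.1 _ (hf.update_injective i x e)
    have hux : f (Function.update x i (a i.succ)) ≠ f x :=
      hf.apply_update_ne fun e => hxi (Or.inl e.symm)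
    have hvx : f (Function.update x i (b i.succ)) ≠ f x :=
      hf.apply_update_ne fun e => hxi (Or.inr e.symm)
    -- Replacing the outside argument by its two distinguished symbols gives two distinct values in
    -- one class, which fill it; `f x` differs from both and so lies in the other class.
    rw [fin4_not_pair _ _ _ _ _ (h.1 0) huv hux hvx (hu.trans hv.symm), hu, Nat.even_add_one]

/-- Both `{a, b}` and its complement are cosets of `{0, a ^^^ b}`, so classes can be described by
translation. -/
lemma fin4_pair_iff : ∀ a b x c : Fin 4, a ≠ b → (c = x ∨ c = x ^^^ (a ^^^ b)) →
    ((c = a ∨ c = b) ↔ (x = a ∨ x = b)) := by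
  decide +kernel

lemma fin4_pair_iff' : ∀ a b x c : Fin 4, a ≠ b → ((c = a ∨ c = b) ↔ (x = a ∨ x = b)) →
    (c = x ∨ c = x ^^^ (a ^^^ b)) := by
  decide +kernel

lemma fin4_ne_xor : ∀ a b x : Fin 4, a ≠ b → x ≠ x ^^^ (a ^^^ b) := by decide

/-- The distinguished classes can be moved to the classes of any point of the code. -/
lemma SemilinearVia.translate (hn : 1 ≤ n) {f : (Fin n → Fin 4) → Fin 4}
    (hf : IsQuasigroup f) {a b : Fin (n + 1) → Fin 4} (h : SemilinearVia f a b)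
    {p : Fin (n + 1) → Fin 4} (hp : p ∈ code f) :
    SemilinearVia f p fun j => p j ^^^ (a j ^^^ b j) := by
  refine semilinearVia_of_forall hn hf (fun j => fin4_ne_xor _ _ _ (h.1 j)) fun x hx => ?_
  apply fin4_pair_iff' _ _ _ _ (h.1 0)
  rw [show p 0 = f fun i => p i.succ from hp, h.apply_mem_iff_even hf, h.apply_mem_iff_even hf]
  simp only [fin4_pair_iff _ _ _ _ (h.1 _) (hx _)]

lemma exists_complement_swap : ∀ a b : Fin 4, a ≠ b → ∃ σ : Equiv.Perm (Fin 4),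
    ∀ c, σ c = if c = a ∨ c = b then c else c ^^^ (a ^^^ b) := by
  decide +kernel

/-- Moving an argument within its class preserves the parity, hence the class of the value; since
the value must change, it becomes the other element of that class. -/
lemma SemilinearVia.apply_update_xor {f : (Fin n → Fin 4) → Fin 4} (hf : IsQuasigroup f)
    {a b : Fin (n + 1) → Fin 4} (h : SemilinearVia f a b) (x : Fin n → Fin 4) (i : Fin n) :
    f (Function.update x i (x i ^^^ (a i.succ ^^^ b i.succ))) = f x ^^^ (a 0 ^^^ b 0) := by
  refine (fin4_pair_iff' _ _ _ _ (h.1 0) ?_).resolve_left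
    (hf.apply_update_ne (fin4_ne_xor _ _ _ (h.1 _)).symm)
  rw [h.apply_mem_iff_even hf, h.apply_mem_iff_even hf]
  have e : ∀ l, (Function.update x i (x i ^^^ (a i.succ ^^^ b i.succ)) l = a l.succ ∨
      Function.update x i (x i ^^^ (a i.succ ^^^ b i.succ)) l = b l.succ) ↔
      (x l = a l.succ ∨ x l = b l.succ) := by
    intro l
    apply fin4_pair_iff _ _ _ _ (h.1 _)
    by_cases hl : l = i
    · subst hl; simp
    · simp [hl]
  simp only [e]

/-- Swapping the elements outside the distinguished class in all arguments is an autotopy. -/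
lemma SemilinearVia.exists_autotopy {f : (Fin n → Fin 4) → Fin 4} (hf : IsQuasigroup f)
    {a b : Fin (n + 1) → Fin 4} (h : SemilinearVia f a b) :
    ∃ θ ∈ autotopyGroup f, ∀ j c, θ j c = if c = a j ∨ c = b j then c else c ^^^ (a j ^^^ b j) := by
  choose θ hθ using fun j => exists_complement_swap (a j) (b j) (h.1 j)
  refine ⟨θ, fun y => ?_, hθ⟩
  -- Arguments are swapped one by one. Each outside argument flips the value within its class, and
  -- by the parity criterion the total number of flips is even exactly when the value is
  -- distinguished.
  have key : ∀ T : Finset (Fin n), f (fun i => if i ∈ T then θ i.succ (y i) else y i) =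
      if Even (T.filter fun i => ¬ (y i = a i.succ ∨ y i = b i.succ)).card then f y
      else f y ^^^ (a 0 ^^^ b 0) := by
    intro T
    induction T using Finset.induction_on with
    | empty => simp
    | insert i T hi ih =>
      rw [Finset.filter_insert]
      by_cases hc : y i = a i.succ ∨ y i = b i.succ
      · rw [if_neg (not_not.2 hc), ← ih]
        congr 1
        funext l
        by_cases hl : l = i
        · subst hl; simp [hi, hθ, hc]
        · simp [hl]
      · rw [if_pos hc, Finset.card_insert_of_notMem (by simp [hi])]
        have e : (fun l => if l ∈ insert i T then θ l.succ (y l) else y l) =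
            Function.update (fun l => if l ∈ T then θ l.succ (y l) else y l) i
              ((fun l => if l ∈ T then θ l.succ (y l) else y l) i ^^^
                (a i.succ ^^^ b i.succ)) := by
          funext l
          by_cases hl : l = i
          · subst hl; simp [hi, hθ, hc]
          · simp [hl]
        rw [e, h.apply_update_xor hf, ih]
        simp only [Nat.even_add_one, ite_not]
        split_ifs <;> first | rfl | exact fin4_xor_cancel_right _ _
  have hk := key Finset.univ
  simp only [Finset.mem_univ, if_true] at hk
  rw [hk, hθ]
  simp only [h.apply_mem_iff_even hf y]

lemma SemilinearVia.of_isotopic {f g : (Fin n → Fin 4) → Fin 4}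
    {φ : Isotopy n (Fin 4)} (hφ : ∀ x, g x = (φ 0)⁻¹ (f fun i => φ i.succ (x i)))
    {a b : Fin (n + 1) → Fin 4} (hn : 1 ≤ n) (hf : IsQuasigroup f) (h : SemilinearVia g a b) :
    SemilinearVia f (fun j => φ j (a j)) fun j => φ j (b j) := by
  refine semilinearVia_of_forall hn hf (fun j e => h.1 j ((φ j).injective e)) fun x hx => ?_
  have h1 := h.apply_mem (x := fun i => (φ i.succ)⁻¹ (x i)) fun i => by
    rw [Equiv.Perm.inv_eq_iff_eq, Equiv.Perm.inv_eq_iff_eq]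
    exact hx i
  rw [hφ, Equiv.Perm.inv_eq_iff_eq, Equiv.Perm.inv_eq_iff_eq] at h1
  simpa only [perm_apply_inv_self] using h1

lemma IsLinear.of_isotopic {f g : (Fin n → Fin 4) → Fin 4} (hn : 1 ≤ n)
    (hf : IsQuasigroup f) (hfg : Isotopic f g) (h : IsLinear g) : IsLinear f := by
  obtain ⟨φ, hφ⟩ := hfg
  intro j c d hcd
  obtain ⟨a, b, hab, he⟩ := h j ((φ j)⁻¹ c) ((φ j)⁻¹ d) fun e => hcd ((φ j)⁻¹.injective e)
  refine ⟨_, _, hab.of_isotopic hφ hn hf, ?_⟩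
  have := congrArg (fun s => φ j '' s) he
  simpa only [Set.image_pair, perm_apply_inv_self] using this

/-! ### Linearity and isotopy to `xorSum` -/

lemma xorSum_mem_of_forall (e : Fin 4) (x y : Fin n → Fin 4)
    (h : ∀ i, y i = x i ∨ y i = x i ^^^ e) :
    xorSum n y = xorSum n x ∨ xorSum n y = xorSum n x ^^^ e := by
  induction n with
  | zero => exact Or.inl rfl
  | succ n ih =>
    have h1 := ih (fun i => x i.castSucc) (fun i => y i.castSucc) fun i => h i.castSucc
    have h2 := h (Fin.last n)
    simp only [xorSum]
    generalize xorSum n _ = p at *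
    generalize xorSum n _ = q at *
    generalize x (Fin.last n) = r at *
    generalize y (Fin.last n) = s at *
    clear ih h x y
    revert p q r s e
    decide +kernel

lemma isLinear_xorSum (hn : 1 ≤ n) : IsLinear (xorSum n) := by
  have key : ∀ (x : Fin n → Fin 4) (e : Fin 4), e ≠ 0 →
      SemilinearVia (xorSum n) (Fin.cons (xorSum n x) x)
        fun j => (Fin.cons (xorSum n x) x : Fin (n + 1) → Fin 4) j ^^^ e := by
    intro x e he
    refine semilinearVia_of_forall hn isQuasigroup_xorSum (fun j => ?_) fun y hy => ?_
    · generalize (Fin.cons (xorSum n x) x : Fin (n + 1) → Fin 4) j = c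
      clear * - he
      revert c e; decide
    · exact xorSum_mem_of_forall e x y hy
  intro j c d hcd
  have hcde : c ^^^ d ≠ 0 := by revert c d; decide
  have hd : ∀ c d : Fin 4, c ^^^ (c ^^^ d) = d := by decide
  obtain ⟨x, hx⟩ : ∃ x : Fin n → Fin 4, (Fin.cons (xorSum n x) x : Fin (n + 1) → Fin 4) j = c := by
    refine Fin.cases ?_ (fun i => ?_) j
    · exact ⟨Function.update (fun _ => 0) ⟨0, hn⟩ c, xorSum_single _ _⟩
    · exact ⟨fun _ => c, rfl⟩
  refine ⟨_, _, key x _ hcde, ?_⟩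
  rw [hx, hd]

lemma isLinear_iff_isotopic_xorSum (hn : 1 ≤ n) {f : (Fin n → Fin 4) → Fin 4}
    (hf : IsQuasigroup f) : IsLinear f ↔ Isotopic f (xorSum n) := by
  refine ⟨fun h => ?_, fun h => (isLinear_xorSum hn).of_isotopic hn hf h⟩
  let p : Fin (n + 1) → Fin 4 := Fin.cons (f 0) 0
  have hp : p ∈ code f := rfl
  have key : ∀ d, f 0 ≠ d → ∃ θ ∈ autotopyGroup f, (∀ j, θ j (p j) = p j) ∧
      ∀ c, θ 0 c = if c = f 0 ∨ c = d then c else c ^^^ (f 0 ^^^ d) := by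
    intro d hd
    obtain ⟨a, b, hab, he⟩ := h 0 (f 0) d hd
    obtain ⟨θ, hθ, hθc⟩ := (hab.translate hn hf hp).exists_autotopy hf
    refine ⟨θ, hθ, fun j => by rw [hθc]; simp, fun c => ?_⟩
    have hx : a 0 ^^^ b 0 = f 0 ^^^ d := by
      rcases Set.pair_eq_pair_iff.1 he with ⟨h1, h2⟩ | ⟨h1, h2⟩
      · rw [h1, h2]
      · rw [h1, h2, fin4_xor_comm]
    have hd' : ∀ c d : Fin 4, c ^^^ (c ^^^ d) = d := by decide
    have hp0 : p 0 = f 0 := rfl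
    rw [hθc, hx, hp0, hd']
  -- The involutions for `{f 0, d}` and `{f 0, d'}` act on values as distinct transpositions of the
  -- three symbols other than `f 0`; their product is a 3-cycle.
  obtain ⟨d, d', hd, hd', hdd⟩ : ∃ d d' : Fin 4, f 0 ≠ d ∧ f 0 ≠ d' ∧ d ≠ d' := by
    generalize f 0 = c
    revert c; decide
  obtain ⟨θ, hθ, hθp, hθ0⟩ := key d hd
  obtain ⟨η, hη, hηp, hη0⟩ := key d' hd'
  refine isotopic_xorSum_of_autotopy hn hf (y := 0) (mul_mem hθ hη) (fun i => ?_) fun c => ?_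
  · have h1 := hηp i.succ
    have h2 := hθp i.succ
    change θ i.succ (η i.succ (p i.succ)) = p i.succ
    rw [h1, h2]
  · change θ 0 (η 0 c) = c ↔ _
    rw [hη0, hθ0]
    generalize f 0 = x at *
    clear * - hd hd' hdd
    revert x d d' c
    decide +kernel

/-! ### Equality cases -/

/-- If the stabilizer of a point in the autotopy group has order `2`, then the quasigroup is
semilinear. -/
lemma isSemilinear_of_card_eq_two (hn : 1 ≤ n) {f : (Fin n → Fin 4) → Fin 4}
    (hf : IsQuasigroup f) {p : Fin (n + 1) → Fin 4}
    (h2 : Nat.card (pointStabilizer f p) = 2) : IsSemilinear f := by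
  have : Nontrivial (pointStabilizer f p) := Finite.one_lt_card_iff_nontrivial.1 (by omega)
  obtain ⟨θ, hθ1⟩ := exists_ne (1 : pointStabilizer f p)
  have hsq : θ ^ 2 = 1 := h2 ▸ pow_card_eq_one'
  have hfix := mem_pointStabilizer.1 θ.2
  have hj1 : ∀ j, θ.1.1 j ≠ 1 := fun j hj => hθ1 <| Subtype.ext <| Subtype.ext <|
    autotopy_eq_one_iff hf θ.1.2 (fun i => hfix i.succ) j hj
  have hj2 : ∀ j, θ.1.1 j ^ 2 = 1 := fun j => by
    have := congrArg (fun η : pointStabilizer f p => η.1.1 j) hsq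
    simpa using this
  -- An involution of four points with a fixed point is a transposition, so it has exactly one other
  -- fixed point.
  have key : ∀ σ : Equiv.Perm (Fin 4), σ ≠ 1 → σ ^ 2 = 1 → ∀ c, σ c = c →
      ∃ d, c ≠ d ∧ ∀ e, σ e = e ↔ e = c ∨ e = d := by decide +kernel
  choose q hpq hq using fun j => key _ (hj1 j) (hj2 j) _ (hfix j)
  refine ⟨p, q, semilinearVia_of_forall hn hf hpq fun x hx => ?_⟩
  rw [← hq, ← θ.1.2]
  congr 1
  funext i
  exact (hq i.succ _).2 (hx i)

/-- After translation the distinguished pairs contain the coordinates of `p`, so swapping their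
complements is a nontrivial autotopy fixing `p`. -/
lemma IsSemilinear.two_le_card (hn : 1 ≤ n) {f : (Fin n → Fin 4) → Fin 4}
    (hf : IsQuasigroup f) (h : IsSemilinear f) {p : Fin (n + 1) → Fin 4} (hp : p ∈ code f) :
    2 ≤ Nat.card (pointStabilizer f p) := by
  obtain ⟨a, b, hab⟩ := h
  have ht := hab.translate hn hf hp
  obtain ⟨θ, hθ, hθc⟩ := ht.exists_autotopy hf
  have hmem : (⟨θ, hθ⟩ : autotopyGroup f) ∈ pointStabilizer f p :=
    mem_pointStabilizer.2 fun j => by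
      change θ j (p j) = p j
      rw [hθc]; simp
  have hne : (⟨⟨θ, hθ⟩, hmem⟩ : pointStabilizer f p) ≠ 1 := by
    intro e
    have e0 : θ 0 = 1 := congrArg (fun η : pointStabilizer f p => η.1.1 0) e
    obtain ⟨c, hc⟩ : ∃ c, ¬ (c = p 0 ∨ c = p 0 ^^^ (a 0 ^^^ b 0)) := by
      generalize p 0 = x
      generalize a 0 ^^^ b 0 = y
      clear * -
      revert x y; decide
    have h1 := hθc 0 c
    rw [if_neg hc, e0] at h1
    refine fin4_ne_xor _ _ c (hab.1 0) (h1.trans ?_)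
    generalize p 0 = x
    generalize a 0 ^^^ b 0 = y
    clear * -
    revert x y c; decide
  exact Finite.one_lt_card_iff_nontrivial.2 ⟨_, _, hne⟩

lemma card_le_two_mul (hn : 1 ≤ n) {f : (Fin n → Fin 4) → Fin 4} (hf : IsQuasigroup f)
    (hlin : ¬ IsLinear f) : Nat.card (autotopyGroup f) ≤ 2 * 4 ^ n := by
  rw [isLinear_iff_isotopic_xorSum hn hf] at hlin
  let p : Fin (n + 1) → Fin 4 := Fin.cons (f 0) 0
  have hp : p ∈ code f := rfl
  exact (card_autotopyGroup_le f hp).trans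
    (Nat.mul_le_mul_right _ (card_pointStabilizer_le_two hn hf hlin hp))

lemma card_eq_two_mul_iff (hn : 1 ≤ n) {f : (Fin n → Fin 4) → Fin 4} (hf : IsQuasigroup f)
    (hlin : ¬ IsLinear f) :
    Nat.card (autotopyGroup f) = 2 * 4 ^ n ↔ IsSemilinear f ∧ AutotopyTransitive f := by
  rw [isLinear_iff_isotopic_xorSum hn hf] at hlin
  let p : Fin (n + 1) → Fin 4 := Fin.cons (f 0) 0
  have hp : p ∈ code f := rfl
  have hS := card_pointStabilizer_le_two hn hf hlin hp
  have hO := Set.ncard_le_ncard (orbit_subset_code hp) (Set.toFinite _)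
  have hO' := hO
  rw [ncard_code] at hO'
  have h4 : 0 < 4 ^ n := by positivity
  constructor
  · intro h
    rw [card_autotopyGroup f p] at h
    -- The stabilizer has order at most 2 and the orbit at most `4 ^ n` points, so equality of the
    -- product forces equality in both factors.
    have h2 : Nat.card (pointStabilizer f p) = 2 := by nlinarith
    refine ⟨isSemilinear_of_card_eq_two hn hf h2, (orbit_eq_code_iff hp).1 ?_⟩
    refine Set.eq_of_subset_of_ncard_le (orbit_subset_code hp) ?_ (Set.toFinite _)
    rw [ncard_code]
    rw [h2] at h
    omega
  · rintro ⟨hs, ht⟩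
    rw [card_autotopyGroup f p, (orbit_eq_code_iff hp).2 ht, ncard_code,
      le_antisymm hS (hs.two_le_card hn hf hp)]

lemma card_eq_six_mul_iff (hn : 1 ≤ n) {f : (Fin n → Fin 4) → Fin 4} (hf : IsQuasigroup f) :
    Nat.card (autotopyGroup f) = 6 * 4 ^ n ↔ IsLinear f := by
  constructor
  · intro h
    by_contra hlin
    have h1 := card_le_two_mul hn hf hlin
    have h4 : 0 < 4 ^ n := by positivity
    omega
  · intro h
    exact le_antisymm (card_le_six_mul hf) ((six_mul_le_card_xorSum hn).trans
      (card_le_card_of_isotopic ((isLinear_iff_isotopic_xorSum hn hf).1 h)))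

/-! ### The cyclic group as extremal nonlinear example -/

/-- The sum modulo `4`. -/
def cyclicSum (n : ℕ) (x : Fin n → Fin 4) : Fin 4 := ∑ i, x i

lemma cyclicSum_update (x : Fin n → Fin 4) (i : Fin n) (a : Fin 4) :
    cyclicSum n (Function.update x i a) = cyclicSum n x - x i + a := by
  have h := Finset.sum_update_of_mem (Finset.mem_univ i) x a
  have h' := Finset.add_sum_erase Finset.univ x (Finset.mem_univ i)
  rw [Finset.sdiff_singleton_eq_erase] at h
  rw [cyclicSum, cyclicSum, h, ← h']
  abel

lemma isQuasigroup_cyclicSum : IsQuasigroup (cyclicSum n) := by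
  intro i x
  rw [← Finite.injective_iff_bijective]
  intro a b h
  simpa only [cyclicSum_update, add_right_inj] using h

lemma isSemilinear_cyclicSum (hn : 1 ≤ n) : IsSemilinear (cyclicSum n) := by
  refine ⟨fun _ => 0, fun _ => 2, semilinearVia_of_forall hn isQuasigroup_cyclicSum
    (fun _ => by decide) fun x hx => ?_⟩
  -- The pair `{0, 2}` is a subgroup, hence closed under sums.
  refine Finset.sum_induction x (fun c => c = 0 ∨ c = 2) (by decide) (Or.inl rfl)
    fun i _ => hx i

lemma autotopyTransitive_cyclicSum : AutotopyTransitive (cyclicSum n) := by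
  intro x hx y hy
  refine ⟨fun j => Equiv.addRight (y j - x j), fun z => ?_, ?_⟩
  · simp only [Equiv.coe_addRight, cyclicSum, Finset.sum_add_distrib, Finset.sum_sub_distrib]
    rw [show x 0 = ∑ i : Fin n, x i.succ from hx, show y 0 = ∑ i : Fin n, y i.succ from hy]
  · funext j
    simp [Isotopy.act]

/-- If values stay in `{0, 1}`, the steps in two arguments must both be `1` or both `-1`; taking
both steps moves the value by 2, outside the pair. For one argument every quasigroup is linear, so
two are needed. -/
lemma not_isLinear_cyclicSum (hn : 2 ≤ n) : ¬ IsLinear (cyclicSum n) := by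
  intro h
  obtain ⟨a, b, hab, he⟩ := h 0 0 1 (by decide)
  let i : Fin n := ⟨0, by omega⟩
  let j : Fin n := ⟨1, by omega⟩
  have hij : j ≠ i := by simp [i, j]
  let x : Fin n → Fin 4 := fun l => a l.succ
  have hmem : ∀ c d, (c = a i.succ ∨ c = b i.succ) → (d = a j.succ ∨ d = b j.succ) →
      cyclicSum n x - a i.succ + c - a j.succ + d = 0 ∨
      cyclicSum n x - a i.succ + c - a j.succ + d = 1 := by
    intro c d hc hd
    have h1 : cyclicSum n (Function.update (Function.update x i c) j d) ∈ ({0, 1} : Set (Fin 4)) := by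
      rw [← he, ← hab.2]
      refine ⟨_, fun l => ?_, rfl⟩
      by_cases hlj : l = j
      · subst hlj; simpa using hd
      · by_cases hli : l = i
        · subst hli; simpa [hlj] using hc
        · simp [hlj, hli, x]
    simpa [cyclicSum_update, hij, x] using h1
  have h00 := hmem _ _ (Or.inl rfl) (Or.inl rfl)
  have h01 := hmem _ _ (Or.inl rfl) (Or.inr rfl)
  have h10 := hmem _ _ (Or.inr rfl) (Or.inl rfl)
  have h11 := hmem _ _ (Or.inr rfl) (Or.inr rfl)
  have hi := hab.1 i.succ
  have hj := hab.1 j.succ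
  generalize cyclicSum n x = s at *
  generalize a i.succ = p at *
  generalize b i.succ = q at *
  generalize a j.succ = r at *
  generalize b j.succ = t at *
  clear * - h00 h01 h10 h11 hi hj
  revert s p q r t
  decide +kernel

end NQuasigroup

theorem mainTheorem3 (n : ℕ) (hn : 1 ≤ n) :
    -- (i)
    (IsGreatest {m : ℕ | ∃ f : (Fin n → Fin 4) → Fin 4, NQuasigroup.IsQuasigroup f ∧
          m = Nat.card (NQuasigroup.autotopyGroup f)} (6 * 4 ^ n) ∧
      ∀ f : (Fin n → Fin 4) → Fin 4, NQuasigroup.IsQuasigroup f →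
        (Nat.card (NQuasigroup.autotopyGroup f) = 6 * 4 ^ n ↔ NQuasigroup.IsLinear f) ∧
        (NQuasigroup.IsLinear f ↔ NQuasigroup.Isotopic f (NQuasigroup.xorSum n))) ∧
    -- (ii)
    ((2 ≤ n → IsGreatest {m : ℕ | ∃ f : (Fin n → Fin 4) → Fin 4,
          NQuasigroup.IsQuasigroup f ∧ ¬ NQuasigroup.IsLinear f ∧
          m = Nat.card (NQuasigroup.autotopyGroup f)} (2 * 4 ^ n)) ∧
      ∀ f : (Fin n → Fin 4) → Fin 4, NQuasigroup.IsQuasigroup f → ¬ NQuasigroup.IsLinear f →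
        Nat.card (NQuasigroup.autotopyGroup f) ≤ 2 * 4 ^ n ∧
        (Nat.card (NQuasigroup.autotopyGroup f) = 2 * 4 ^ n ↔
          NQuasigroup.IsSemilinear f ∧ NQuasigroup.AutotopyTransitive f)) := by
  open NQuasigroup in
  refine ⟨⟨⟨⟨xorSum n, isQuasigroup_xorSum, ?_⟩, ?_⟩, fun f hf =>
    ⟨card_eq_six_mul_iff hn hf, isLinear_iff_isotopic_xorSum hn hf⟩⟩, fun h2 =>
    ⟨⟨cyclicSum n, isQuasigroup_cyclicSum, not_isLinear_cyclicSum h2, ?_⟩, ?_⟩,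
    fun f hf hlin => ⟨card_le_two_mul hn hf hlin, card_eq_two_mul_iff hn hf hlin⟩⟩
  · exact ((card_eq_six_mul_iff hn isQuasigroup_xorSum).2 (isLinear_xorSum hn)).symm
  · rintro _ ⟨f, hf, rfl⟩
    exact card_le_six_mul hf
  · exact ((card_eq_two_mul_iff hn isQuasigroup_cyclicSum (not_isLinear_cyclicSum h2)).2
      ⟨isSemilinear_cyclicSum hn, autotopyTransitive_cyclicSum⟩).symm
  · rintro _ ⟨f, hf, hlin, rfl⟩
    exact card_le_two_mul hn hf hlin
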